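/- Let $E$ be a linear subspace of $\mathbb{R}^d$ with $\dim E=k$, and let $V_E\in\mathbb{R}^{d\times k}$ and $V_{E^\perp}\in\mathbb{R}^{d\times(d-k)}$ be matrices whose columns form orthonormal bases of $E$ and of its orthogonal complement $E^\perp$. Let $A,B\in\mathbb{R}^{d\times d}$ be symmetric positive semidefinite and put $\mu=\mathcal N(0_d,A)$, $\nu=\mathcal N(0_d,B)$ (Gaussians may be degenerate). Write $A_E=V_E^\top A V_E$, $A_{EE^\perp}=V_E^\top A V_{E^\perp}$, $B_E=V_E^\top B V_E$, $B_{EE^\perp}=V_E^\top B V_{E^\perp}$, and assume that $A_E$ and $B_E$ are positive definite. For a probability measure $\rho$ on $\mathbb{R}^d$ let $\rho_E=(P_E)_\sharp\rho$ be its image under the orthogonal projection $P_E$ onto $E$. A disintegration of $\rho$ on $E$ is a measurable family $(\rho_{x_E})_{x_E\in E}$ of probability measures on $\mathbb{R}^d$ such that $\rho_{x_E}$ is carried by the fiber $\{x: P_E x=x_E\}$ for $\rho_E$-almost every $x_E$, and $\rho=\int_E\rho_{x_E}\,d\rho_E(x_E)$. A Monge map from $\mu_E$ to $\nu_E$ is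 a measurable map $S:E\to E$ with $S_\sharp\mu_E=\nu_E$ that minimizes $\int_E\|x-S(x)\|^2\,d\mu_E(x)$ among all such maps. A Monge-Independent plan between $\mu$ and $\nu$ is a measure on $\mathbb{R}^d\times\mathbb{R}^d$ of the form $$\pi_{\mathrm{MI}}(\mu,\nu)=(\mu_{x_E}\otimes\nu_{S(x_E)})\otimes(\mathrm{Id}_E,S)_\sharp\mu_E=\int_E\mu_{x_E}\otimes\nu_{S(x_E)}\,d\mu_E(x_E),$$ where $S$ is a Monge map from $\mu_E$ to $\nu_E$ and $(\mu_{x_E})$, $(\nu_{y_E})$ are disintegrations of $\mu$ and $\nu$ on $E$. Let $T^{A_EB_E}=A_E^{-1/2}\bigl(A_E^{1/2}B_EA_E^{1/2}\bigr)^{1/2}A_E^{-1/2}$ and $$C=\bigl(V_EA_E+V_{E^\perp}A_{EE^\perp}^\top\bigr)\,T^{A_EB_E}\,\bigl(V_E^\top+B_E^{-1}B_{EE^\perp}V_{E^\perp}^\top\bigr),\qquad \Sigma=\begin{pmatrix}A&C\\ C^\top&B\end{pmatrix}.$$ Then $\Sigma$ is positive semidefinite, and there is exactly one Monge-Independent plan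 between $\mu$ and $\nu$, namely the (possibly degenerate) Gaussian measure $\pi_{\mathrm{MI}}(\mu,\nu)=\mathcal N(0_{2d},\Sigma)$ on $\mathbb{R}^d\times\mathbb{R}^d$. -/

import Mathlib

open MeasureTheory ProbabilityTheory Matrix
open scoped ENNReal MatrixOrder

noncomputable section

namespace SubspaceDetours

/-- The marginal `μ_E` of a measure `μ` on `ℝᵈ` on the subspace `E`: its push-forward under the
orthogonal projection onto `E`. -/
def marginal {d : ℕ} (E : Submodule ℝ (EuclideanSpace ℝ (Fin d)))
    (μ : Measure (EuclideanSpace ℝ (Fin d))) : Measure E :=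
  μ.map E.orthogonalProjectionOnto

/-- A kernel `x_E ↦ μ_{x_E}` of probability measures is a disintegration of `μ` on `E` if almost
every `μ_{x_E}` is carried by the fiber `{x | P_E x = x_E}` and `μ` is the `μ_E`-mixture of the
measures `μ_{x_E}`. -/
structure IsDisintegration {d : ℕ} (E : Submodule ℝ (EuclideanSpace ℝ (Fin d)))
    (μ : Measure (EuclideanSpace ℝ (Fin d))) (κ : Kernel E (EuclideanSpace ℝ (Fin d))) : Prop where
  isMarkovKernel : IsMarkovKernel κ
  fiber : ∀ᵐ xE ∂(marginal E μ), ∀ᵐ x ∂(κ xE), E.orthogonalProjectionOnto x = xE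
  mixture : κ ∘ₘ marginal E μ = μ

/-- `T` is a Monge map from `μ` to `ν`: a measurable transport map `T_♯ μ = ν` which has the least
quadratic cost `∫ ‖x - T x‖² dμ` among all of them. -/
structure IsMongeMap {F : Type*} [NormedAddCommGroup F] [MeasurableSpace F]
    (μ ν : Measure F) (T : F → F) : Prop where
  measurable : Measurable T
  map_eq : μ.map T = ν
  optimal : ∀ T' : F → F, Measurable T' → μ.map T' = ν →
    ∫⁻ x, ‖x - T x‖ₑ ^ 2 ∂μ ≤ ∫⁻ x, ‖x - T' x‖ₑ ^ 2 ∂μ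

/-- `π` is a Monge-Independent plan between `μ` and `ν` for the subspace `E`:
`π = (μ_{x_E} ⊗ ν_{S(x_E)}) ⊗ (Id_E, S)_♯ μ_E`, with `S` a Monge map from `μ_E` to `ν_E` and
`μ_{x_E}`, `ν_{y_E}` disintegrations of `μ` and `ν` on `E`. -/
def IsMongeIndependentPlan {d : ℕ} (E : Submodule ℝ (EuclideanSpace ℝ (Fin d)))
    (μ ν : Measure (EuclideanSpace ℝ (Fin d)))
    (π : Measure (EuclideanSpace ℝ (Fin d) × EuclideanSpace ℝ (Fin d))) : Prop :=
  ∃ (S : E → E) (κ η : Kernel E (EuclideanSpace ℝ (Fin d))),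
    IsMongeMap (marginal E μ) (marginal E ν) S ∧
    IsDisintegration E μ κ ∧ IsDisintegration E ν η ∧
    π = ((marginal E μ).map fun xE => (xE, S xE)).bind fun p => (κ p.1).prod (η p.2)

/-- The matrix `V_F ∈ ℝ^{d × k}` whose columns are the vectors of an orthonormal basis of `F`. -/
def basisMatrix {d k : ℕ} {F : Submodule ℝ (EuclideanSpace ℝ (Fin d))}
    (v : OrthonormalBasis (Fin k) ℝ F) : Matrix (Fin d) (Fin k) ℝ :=
  Matrix.of fun i j => (v j : EuclideanSpace ℝ (Fin d)) i

/-- `T^{AB} = A^{-1/2} (A^{1/2} B A^{1/2})^{1/2} A^{-1/2}`. -/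
def mongeMatrix {k : ℕ} (A B : Matrix (Fin k) (Fin k) ℝ) : Matrix (Fin k) (Fin k) ℝ :=
  (CFC.sqrt A)⁻¹ * CFC.sqrt (CFC.sqrt A * B * CFC.sqrt A) * (CFC.sqrt A)⁻¹

/-- The cross-covariance
`C = (V A_E + W A_{EE^⊥}ᵀ) T^{A_E B_E} (Vᵀ + B_E⁻¹ B_{EE^⊥} Wᵀ)`, where `V = V_E`, `W = V_{E^⊥}` and
`A_E = Vᵀ A V`, `A_{EE^⊥} = Vᵀ A W`, `B_E = Vᵀ B V`, `B_{EE^⊥} = Vᵀ B W`. -/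
def crossCovariance {d k m : ℕ} (A B : Matrix (Fin d) (Fin d) ℝ)
    (V : Matrix (Fin d) (Fin k) ℝ) (W : Matrix (Fin d) (Fin m) ℝ) : Matrix (Fin d) (Fin d) ℝ :=
  (V * (Vᵀ * A * V) + W * (Vᵀ * A * W)ᵀ) * mongeMatrix (Vᵀ * A * V) (Vᵀ * B * V) *
    (Vᵀ + (Vᵀ * B * V)⁻¹ * (Vᵀ * B * W) * Wᵀ)

/-- The Gaussian measure `N(0, S)` on `ℝᵈ × ℝᵈ`, where `S` is a covariance matrix indexed by the
`d` coordinates of the first factor followed by the `d` coordinates of the second one. -/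
def gaussianProd {d : ℕ} (S : Matrix (Fin d ⊕ Fin d) (Fin d ⊕ Fin d) ℝ) :
    Measure (EuclideanSpace ℝ (Fin d) × EuclideanSpace ℝ (Fin d)) :=
  (multivariateGaussian 0 S).map EuclideanSpace.sumEquivProd

end SubspaceDetours

end

/-!
The argument rests on three facts.

*Uniqueness of the ingredients.* A disintegration on `E` is determined almost everywhere,
because `x_E = P_E x` fixes the joint law of `(x_E, x)` (`IsDisintegration.compProd_marginal`).
For the Monge map, let `T` be linear with a symmetric positive definite inverse `T'`. Then
`‖x - y‖²` is a function of `x`, plus a function of `y`, plus the quadratic form of `T'` at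
`y - T x`. Hence a map `S` with the same image measure as `T` costs exactly
`∫ ⟪T' (S x - T x), S x - T x⟫ dμ` more than `T` (`lintegral_enorm_sub_sq_eq_add`), so `T` is
optimal and any other optimal map equals `T` almost everywhere. For the Gaussian marginals this
applies to the matrix `T = T^{A_E B_E}`, which is positive definite and satisfies
`T A_E T = B_E`.

*An explicit disintegration.* Let `V = V_E`, let `L = B V B_E⁻¹` be the matrix of the linear
regression on the coordinates in `E`, and let `R = 1 - L Vᵀ` be that of the residual. As
`L B_E Lᵀ + R B Rᵀ = B`, the laws of `L Vᵀ y + R z`, with `z ~ N(0, B)` and `y ∈ E`,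
disintegrate `N(0, B)` on `E` (`isDisintegration_fiberKernel`).

*The plan.* The disintegration of `μ` integrates out (`bind_prod_eq_compProd`): every
Monge-Independent plan is the law of `(x, L T Vᵀ x + R z)` with `x ~ μ` and `z ~ ν` independent.
This is a linear image of a Gaussian vector, with second block
`L T A_E T Lᵀ + R B Rᵀ = L B_E Lᵀ + R B Rᵀ = B` and off-diagonal block `A V T Lᵀ`, which is `C`
because `V Vᵀ + W Wᵀ = 1` for `W = V_{E^⊥}`. In particular `Σ` is a covariance matrix and hence
positive semidefinite.
-/

namespace SubspaceDetours

/-! ### Disintegrations -/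

section Disintegration

variable {d : ℕ} {E : Submodule ℝ (EuclideanSpace ℝ (Fin d))}
  {μ ν : Measure (EuclideanSpace ℝ (Fin d))} {κ η η' : Kernel E (EuclideanSpace ℝ (Fin d))}

instance [IsFiniteMeasure μ] : IsFiniteMeasure (marginal E μ) := by
  unfold marginal; infer_instance

/-- The joint law of `(x_E, x)` is determined by `μ` alone, because `x_E = P_E x` almost surely. -/
lemma IsDisintegration.compProd_marginal [IsFiniteMeasure μ] (h : IsDisintegration E μ κ) :
    marginal E μ ⊗ₘ κ = μ.map fun x => (E.orthogonalProjectionOnto x, x) := by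
  have := h.isMarkovKernel
  have hm : Measurable fun x : EuclideanSpace ℝ (Fin d) => (E.orthogonalProjectionOnto x, x) := by
    fun_prop
  ext s hs
  rw [Measure.compProd_apply hs, Measure.map_apply hm hs]
  conv_rhs => rw [← h.mixture]
  rw [Measure.bind_apply (hm hs) κ.aemeasurable]
  refine lintegral_congr_ae ?_
  filter_upwards [h.fiber] with y hy
  refine measure_congr ?_
  filter_upwards [hy] with x hx
  change ((y, x) ∈ s) = ((E.orthogonalProjectionOnto x, x) ∈ s)
  rw [hx]

lemma IsDisintegration.ae_eq [IsFiniteMeasure μ] (h : IsDisintegration E μ κ)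
    (h' : IsDisintegration E μ η) : κ =ᵐ[marginal E μ] η := by
  have := h.isMarkovKernel
  have := h'.isMarkovKernel
  exact Kernel.ae_eq_of_compProd_eq (h.compProd_marginal.trans h'.compProd_marginal.symm)

/-- A Monge-Independent plan only depends on the almost everywhere classes of the Monge map and of
the disintegrations, and the disintegration of the first measure can be integrated out:
the second component is drawn from `η'` at `T (P_E x)` once the first component `x` is drawn
from `μ`. -/
lemma bind_prod_eq_compProd [IsFiniteMeasure μ] {S T : E → E}
    (hS : Measurable S) (hT : Measurable T) (hSν : (marginal E μ).map S = marginal E ν)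
    (hST : S =ᵐ[marginal E μ] T) (hκ : IsDisintegration E μ κ) [IsMarkovKernel η]
    [IsMarkovKernel η'] (hη : η =ᵐ[marginal E ν] η') :
    (((marginal E μ).map fun x => (x, S x)).bind fun p => (κ p.1).prod (η p.2)) =
      μ ⊗ₘ (η'.comap (fun x => T (E.orthogonalProjectionOnto x)) (by fun_prop)) := by
  have := hκ.isMarkovKernel
  have hmS : Measurable fun x => (x, S x) := by fun_prop
  have hprod : Measurable fun p : E × E => (κ p.1).prod (η p.2) := by
    have h := ((κ.comap Prod.fst measurable_fst) ×ₖ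
      (η.comap (Prod.snd : E × E → E) measurable_snd)).measurable
    convert h using 2 with p
    simp [Kernel.prod_apply]
  ext s hs
  have hmeas : Measurable fun x => η' (T (E.orthogonalProjectionOnto x)) (Prod.mk x ⁻¹' s) :=
    Kernel.measurable_kernel_prodMk_left
      (κ := η'.comap (fun x => T (E.orthogonalProjectionOnto x)) (by fun_prop)) hs
  rw [Measure.bind_apply hs hprod.aemeasurable,
    lintegral_map (f := fun p => ((κ p.1).prod (η p.2)) s)
      ((Measure.measurable_coe hs).comp hprod) hmS, Measure.compProd_apply hs]
  simp only [Kernel.comap_apply]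
  conv_rhs => rw [← hκ.mixture]
  rw [Measure.lintegral_bind κ.aemeasurable hmeas.aemeasurable]
  rw [← hSν] at hη
  refine lintegral_congr_ae ?_
  filter_upwards [hκ.fiber, hST, ae_of_ae_map hS.aemeasurable hη] with y hy hSy hηy
  rw [Measure.prod_apply hs, hηy, hSy]
  refine lintegral_congr_ae ?_
  filter_upwards [hy] with x hx
  rw [hx]

end Disintegration

/-! ### Monge maps with a symmetric positive definite linear part -/

section Monge

variable {F : Type*} [NormedAddCommGroup F] [InnerProductSpace ℝ F]

local notation "⟪" x ", " y "⟫" => inner ℝ x y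

/-- If `T'` is symmetric and a left inverse of `T`, the transport cost `‖x - y‖²` splits into a
function of `x`, a function of `y` and the quadratic form of `T'` at `y - T x`. -/
lemma norm_sub_sq_eq_of_leftInverse {T T' : F →L[ℝ] F} (hsymm : ∀ x y, ⟪T' x, y⟫ = ⟪x, T' y⟫)
    (hinv : ∀ x, T' (T x) = x) (x y : F) :
    ‖x - y‖ ^ 2 = (‖x‖ ^ 2 - ⟪x, T x⟫) + (‖y‖ ^ 2 - ⟪T' y, y⟫) + ⟪T' (y - T x), y - T x⟫ := by
  rw [norm_sub_sq_real, map_sub, hinv, inner_sub_left, inner_sub_right, inner_sub_right,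
    hsymm y (T x), hinv, real_inner_comm x y]
  ring

lemma integrable_inner_of_memLp_two {α : Type*} [MeasurableSpace α] {μ : Measure α} {f g : α → F}
    (hf : MemLp f 2 μ) (hg : MemLp g 2 μ) : Integrable (fun x => ⟪f x, g x⟫) μ := by
  refine (hf.norm.integrable_mul hg.norm).mono'
    (hf.aestronglyMeasurable.inner hg.aestronglyMeasurable) ?_
  exact Filter.Eventually.of_forall fun x => norm_inner_le_norm _ _

variable [MeasurableSpace F] [BorelSpace F] [SecondCountableTopology F] {μ : Measure F}

/-- The excess cost of a transport map `S` over the cost of `T` is the integral of the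
quadratic form of `T'` at `S x - T x`. -/
lemma lintegral_enorm_sub_sq_eq_add {T T' : F →L[ℝ] F} (hsymm : ∀ x y, ⟪T' x, y⟫ = ⟪x, T' y⟫)
    (hinv : ∀ x, T' (T x) = x) (hpos : ∀ x, 0 ≤ ⟪T' x, x⟫) (hμ : MemLp id 2 μ) {S : F → F}
    (hS : Measurable S) (hmap : μ.map S = μ.map T) :
    ∫⁻ x, ‖x - S x‖ₑ ^ 2 ∂μ = ∫⁻ x, ‖x - T x‖ₑ ^ 2 ∂μ +
      ∫⁻ x, ENNReal.ofReal ⟪T' (S x - T x), S x - T x⟫ ∂μ := by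
  have hTL : MemLp T 2 μ := T.comp_memLp' hμ
  have hν : MemLp id 2 (μ.map T) := by
    rw [memLp_map_measure_iff (by fun_prop) (by fun_prop)]; exact hTL
  have hSL : MemLp S 2 μ := by
    rw [← hmap, memLp_map_measure_iff (by fun_prop) hS.aemeasurable] at hν; exact hν
  have hcost {R : F → F} (hR : MemLp R 2 μ) :
      ∫⁻ x, ‖x - R x‖ₑ ^ 2 ∂μ = ENNReal.ofReal (∫ x, ‖x - R x‖ ^ 2 ∂μ) ∧
        Integrable (fun x => ‖x - R x‖ ^ 2) μ := by
    have hi : Integrable (fun x => ‖x - R x‖ ^ 2) μ :=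
      (hμ.sub hR).integrable_norm_pow two_ne_zero
    refine ⟨?_, hi⟩
    rw [ofReal_integral_eq_lintegral_ofReal hi (ae_of_all _ fun x => by positivity)]
    refine lintegral_congr fun x => ?_
    rw [ENNReal.ofReal_pow (norm_nonneg _), ofReal_norm]
  have hf : Integrable (fun x => ‖x‖ ^ 2 - ⟪x, T x⟫) μ :=
    (hμ.integrable_norm_pow two_ne_zero).sub (integrable_inner_of_memLp_two hμ hTL)
  have hg : Integrable (fun y => ‖y‖ ^ 2 - ⟪T' y, y⟫) (μ.map T) :=
    (hν.integrable_norm_pow two_ne_zero).sub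
      (integrable_inner_of_memLp_two (T'.comp_memLp' hν) hν)
  have hq : Integrable (fun x => ⟪T' (S x - T x), S x - T x⟫) μ :=
    integrable_inner_of_memLp_two (T'.comp_memLp' (hSL.sub hTL)) (hSL.sub hTL)
  have hgS : Integrable (fun x => ‖S x‖ ^ 2 - ⟪T' (S x), S x⟫) μ := by
    rw [← hmap] at hg; exact hg.comp_measurable hS
  have hgT : Integrable (fun x => ‖T x‖ ^ 2 - ⟪T' (T x), T x⟫) μ :=
    hg.comp_measurable (by fun_prop)
  -- Both maps have the same image measure, so they integrate functions of `y` equally.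
  have hgeq : ∫ x, (‖S x‖ ^ 2 - ⟪T' (S x), S x⟫) ∂μ = ∫ x, (‖T x‖ ^ 2 - ⟪T' (T x), T x⟫) ∂μ := by
    rw [← integral_map (φ := T) (f := fun y => ‖y‖ ^ 2 - ⟪T' y, y⟫) (by fun_prop)
      hg.aestronglyMeasurable, ← hmap, integral_map hS.aemeasurable]
    rw [hmap]; exact hg.aestronglyMeasurable
  rw [(hcost hSL).1, (hcost hTL).1,
    ← ofReal_integral_eq_lintegral_ofReal hq (ae_of_all _ fun x => hpos _),
    ← ENNReal.ofReal_add (integral_nonneg fun x => by positivity) (integral_nonneg fun x => hpos _)]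
  congr 1
  simp_rw [norm_sub_sq_eq_of_leftInverse hsymm hinv]
  have hfg : Integrable (fun x => ‖x‖ ^ 2 - ⟪x, T x⟫ + (‖S x‖ ^ 2 - ⟪T' (S x), S x⟫)) μ :=
    hf.add hgS
  rw [integral_add hfg hq, integral_add hf hgS, hgeq, ← integral_add hf hgT]
  simp

lemma isMongeMap_of_leftInverse {T T' : F →L[ℝ] F} (hsymm : ∀ x y, ⟪T' x, y⟫ = ⟪x, T' y⟫)
    (hinv : ∀ x, T' (T x) = x) (hpos : ∀ x, 0 ≤ ⟪T' x, x⟫) (hμ : MemLp id 2 μ) :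
    IsMongeMap μ (μ.map T) T where
  measurable := by fun_prop
  map_eq := rfl
  optimal S hS hmap := by
    rw [lintegral_enorm_sub_sq_eq_add hsymm hinv hpos hμ hS hmap]
    exact le_self_add

/-- If the quadratic form of `T'` is definite, a Monge map has excess cost zero over `T` and
therefore agrees with it almost everywhere. -/
lemma IsMongeMap.ae_eq_of_leftInverse {T T' : F →L[ℝ] F}
    (hsymm : ∀ x y, ⟪T' x, y⟫ = ⟪x, T' y⟫) (hinv : ∀ x, T' (T x) = x)
    (hpos : ∀ x, x ≠ 0 → 0 < ⟪T' x, x⟫) (hμ : MemLp id 2 μ) {S : F → F}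
    (hS : IsMongeMap μ (μ.map T) S) : S =ᵐ[μ] T := by
  have hpos' : ∀ x, 0 ≤ ⟪T' x, x⟫ := fun x => by
    rcases eq_or_ne x 0 with rfl | hx
    · simp
    · exact (hpos x hx).le
  have hfin : ∫⁻ x, ‖x - T x‖ₑ ^ 2 ∂μ ≠ ∞ := by
    have h : MemLp (fun x => x - T x) 2 μ := hμ.sub (T.comp_memLp' hμ)
    have := (h.integrable_norm_pow two_ne_zero).hasFiniteIntegral
    simpa [HasFiniteIntegral, enorm_pow] using this.ne
  have hle := hS.optimal T (by fun_prop) rfl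
  rw [lintegral_enorm_sub_sq_eq_add hsymm hinv hpos' hμ hS.measurable hS.map_eq] at hle
  have h0 : ∫⁻ x, ENNReal.ofReal ⟪T' (S x - T x), S x - T x⟫ ∂μ = 0 := by
    by_contra h
    exact (ENNReal.lt_add_right hfin h).not_ge hle
  have hSm := hS.measurable
  rw [lintegral_eq_zero_iff (by fun_prop)] at h0
  filter_upwards [h0] with x hx
  by_contra hne
  have := hpos _ (sub_ne_zero.2 hne)
  simp only [Pi.zero_apply, ENNReal.ofReal_eq_zero] at hx
  linarith

end Monge

/-! ### The matrix `T^{AB}` -/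

section MongeMatrix

variable {k : ℕ} {A B : Matrix (Fin k) (Fin k) ℝ}

lemma posDef_sqrt (hA : A.PosDef) : (CFC.sqrt A).PosDef := by
  rw [(CFC.sqrt_nonneg A).posSemidef.posDef_iff_isUnit]
  exact (CFC.isUnit_sqrt_iff A hA.posSemidef.nonneg).2 hA.isUnit

lemma posDef_mongeMatrix (hA : A.PosDef) (hB : B.PosDef) : (mongeMatrix A B).PosDef := by
  have hQ := posDef_sqrt hA
  have hQT : (CFC.sqrt A)ᴴ = CFC.sqrt A := hQ.isHermitian
  have hR : (CFC.sqrt A * B * CFC.sqrt A).PosDef := by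
    have := hB.mul_mul_conjTranspose_same (B := CFC.sqrt A)
      (Matrix.vecMul_injective_of_isUnit hQ.isUnit)
    rwa [hQT] at this
  have := (posDef_sqrt hR).mul_mul_conjTranspose_same (B := (CFC.sqrt A)⁻¹)
    (Matrix.vecMul_injective_of_isUnit hQ.inv.isUnit)
  rwa [hQ.inv.isHermitian.eq] at this

/-- `T^{AB}` transports the covariance `A` to the covariance `B`. -/
lemma mongeMatrix_mul_mul_mongeMatrix (hA : A.PosDef) (hB : B.PosSemidef) :
    mongeMatrix A B * A * mongeMatrix A B = B := by
  have hQ := posDef_sqrt hA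
  have hdet : IsUnit (CFC.sqrt A).det := (Matrix.isUnit_iff_isUnit_det _).1 hQ.isUnit
  have hQT : (CFC.sqrt A)ᴴ = CFC.sqrt A := hQ.isHermitian
  have hR : 0 ≤ CFC.sqrt A * B * CFC.sqrt A := by
    have := hB.mul_mul_conjTranspose_same (CFC.sqrt A)
    rw [hQT] at this
    exact this.nonneg
  have hQQ : CFC.sqrt A * CFC.sqrt A = A := CFC.sqrt_mul_sqrt_self A hA.posSemidef.nonneg
  have hRR := CFC.sqrt_mul_sqrt_self (CFC.sqrt A * B * CFC.sqrt A) hR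
  unfold mongeMatrix
  set Q := CFC.sqrt A
  set R := CFC.sqrt (Q * B * Q)
  calc Q⁻¹ * R * Q⁻¹ * A * (Q⁻¹ * R * Q⁻¹)
      = Q⁻¹ * R * (Q⁻¹ * Q) * (Q * Q⁻¹) * R * Q⁻¹ := by rw [← hQQ]; simp only [Matrix.mul_assoc]
    _ = Q⁻¹ * (R * R) * Q⁻¹ := by
      rw [Matrix.nonsing_inv_mul _ hdet, Matrix.mul_nonsing_inv _ hdet]
      simp only [Matrix.mul_assoc, Matrix.mul_one]
    _ = (Q⁻¹ * Q) * B * (Q * Q⁻¹) := by rw [hRR]; simp only [Matrix.mul_assoc]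
    _ = B := by
      rw [Matrix.nonsing_inv_mul _ hdet, Matrix.mul_nonsing_inv _ hdet, Matrix.mul_one,
        Matrix.one_mul]

end MongeMatrix

/-! ### Linear images of Gaussian measures -/

section Gaussian

variable {m n p : Type*} [Fintype m] [Fintype n] [DecidableEq n] [Fintype p] [DecidableEq p]

/-- The continuous linear map `x ↦ M x` between Euclidean spaces given by a matrix `M`. -/
noncomputable def matrixCLM (M : Matrix m n ℝ) : EuclideanSpace ℝ n →L[ℝ] EuclideanSpace ℝ m :=
  (Matrix.toLpLin 2 2 M).toContinuousLinearMap

@[simp]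
lemma ofLp_matrixCLM (M : Matrix m n ℝ) (x : EuclideanSpace ℝ n) :
    (matrixCLM M x).ofLp = M *ᵥ x.ofLp := rfl

lemma matrixCLM_matrixCLM (M : Matrix m n ℝ) (N : Matrix n p ℝ) (x : EuclideanSpace ℝ p) :
    matrixCLM M (matrixCLM N x) = matrixCLM (M * N) x := by
  apply (WithLp.equiv 2 _).injective
  simp [Matrix.mulVec_mulVec]

@[simp]
lemma matrixCLM_one (x : EuclideanSpace ℝ n) : matrixCLM (1 : Matrix n n ℝ) x = x := by
  apply (WithLp.equiv 2 _).injective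
  simp

@[simp]
lemma matrixCLM_zero (x : EuclideanSpace ℝ n) : matrixCLM (0 : Matrix m n ℝ) x = 0 := by
  apply (WithLp.equiv 2 _).injective
  simp

lemma inner_matrixCLM_left [DecidableEq m] (M : Matrix m n ℝ) (x : EuclideanSpace ℝ n)
    (y : EuclideanSpace ℝ m) :
    inner ℝ (matrixCLM M x) y = inner ℝ x (matrixCLM Mᵀ y) := by
  simp only [EuclideanSpace.inner_eq_star_dotProduct, ofLp_matrixCLM, star_trivial]
  rw [Matrix.dotProduct_mulVec, ← Matrix.mulVec_transpose]

lemma posSemidef_mul_mul_transpose {m n : Type*} [Fintype m] [Fintype n] {A : Matrix n n ℝ}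
    (hA : A.PosSemidef) (M : Matrix m n ℝ) : (M * A * Mᵀ).PosSemidef := by
  simpa using hA.mul_mul_conjTranspose_same M

lemma charFun_map_matrixCLM [DecidableEq m] (μ : Measure (EuclideanSpace ℝ n))
    (M : Matrix m n ℝ) (t : EuclideanSpace ℝ m) :
    charFun (μ.map (matrixCLM M)) t = charFun μ (matrixCLM Mᵀ t) := by
  rw [charFun_apply, charFun_apply, integral_map (by fun_prop) (by fun_prop)]
  simp_rw [inner_matrixCLM_left]

lemma map_matrixCLM_multivariateGaussian [DecidableEq m] {A : Matrix n n ℝ} (hA : A.PosSemidef)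
    (M : Matrix m n ℝ) :
    (multivariateGaussian 0 A).map (matrixCLM M) = multivariateGaussian 0 (M * A * Mᵀ) := by
  refine Measure.ext_of_charFun (funext fun t => ?_)
  rw [charFun_map_matrixCLM, charFun_multivariateGaussian hA,
    charFun_multivariateGaussian (posSemidef_mul_mul_transpose hA M)]
  simp [← Matrix.mulVec_mulVec, Matrix.mulVec_transpose, Matrix.dotProduct_mulVec]

/-- The sum of linear images of two independent centred Gaussian vectors is Gaussian. -/
lemma map_add_matrixCLM_prod_multivariateGaussian [DecidableEq m] {A : Matrix n n ℝ}
    {B : Matrix p p ℝ} (hA : A.PosSemidef) (hB : B.PosSemidef) (M : Matrix m n ℝ)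
    (N : Matrix m p ℝ) :
    ((multivariateGaussian 0 A).prod (multivariateGaussian 0 B)).map
        (fun z => matrixCLM M z.1 + matrixCLM N z.2) =
      multivariateGaussian 0 (M * A * Mᵀ + N * B * Nᵀ) := by
  have hM := posSemidef_mul_mul_transpose hA M
  have hN := posSemidef_mul_mul_transpose hB N
  have h : ((multivariateGaussian 0 A).prod (multivariateGaussian 0 B)).map
        (fun z => matrixCLM M z.1 + matrixCLM N z.2) =
      (multivariateGaussian 0 (M * A * Mᵀ)).conv (multivariateGaussian 0 (N * B * Nᵀ)) := by
    rw [Measure.conv, ← map_matrixCLM_multivariateGaussian hA,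
      ← map_matrixCLM_multivariateGaussian hB, Measure.map_prod_map _ _ (by fun_prop) (by fun_prop),
      Measure.map_map (by fun_prop) (by fun_prop)]
    rfl
  rw [h]
  refine Measure.ext_of_charFun (funext fun t => ?_)
  rw [charFun_conv, charFun_multivariateGaussian hM, charFun_multivariateGaussian hN,
    charFun_multivariateGaussian (hM.add hN), ← Complex.exp_add]
  congr 1
  simp [Matrix.add_mulVec, dotProduct_add]
  ring

lemma fromRows_one_mul_mul_transpose_add {m n p : Type*} [Fintype n] [DecidableEq n] [Fintype p]
    (A : Matrix n n ℝ) (B : Matrix p p ℝ)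
    (G : Matrix m n ℝ) (H : Matrix m p ℝ) :
    fromRows 1 G * A * (fromRows 1 G)ᵀ + fromRows 0 H * B * (fromRows 0 H)ᵀ =
      fromBlocks A (A * Gᵀ) (G * A) (G * A * Gᵀ + H * B * Hᵀ) := by
  ext (i | i) (j | j) <;> simp [transpose_fromRows, fromRows_mul]

/-- If `x ~ N(0, A)` and `z ~ N(0, B)` are independent, then `(x, G x + H z)` is Gaussian. -/
lemma map_prod_multivariateGaussian_eq_gaussianProd {d : ℕ} {A B : Matrix (Fin d) (Fin d) ℝ}
    (hA : A.PosSemidef) (hB : B.PosSemidef) (G H : Matrix (Fin d) (Fin d) ℝ) :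
    ((multivariateGaussian 0 A).prod (multivariateGaussian 0 B)).map
        (fun z => (z.1, matrixCLM G z.1 + matrixCLM H z.2)) =
      gaussianProd (fromBlocks A (A * Gᵀ) (G * A) (G * A * Gᵀ + H * B * Hᵀ)) := by
  rw [gaussianProd, ← fromRows_one_mul_mul_transpose_add,
    ← map_add_matrixCLM_prod_multivariateGaussian hA hB,
    Measure.map_map (by fun_prop) (by fun_prop)]
  congr 1
  funext z
  refine Prod.ext ?_ ?_ <;> ext i <;>
    simp [EuclideanSpace.sumEquivProd, fromRows_mulVec]

lemma posSemidef_fromBlocks_mul {d : ℕ} {A B : Matrix (Fin d) (Fin d) ℝ}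
    (hA : A.PosSemidef) (hB : B.PosSemidef) (G H : Matrix (Fin d) (Fin d) ℝ) :
    (fromBlocks A (A * Gᵀ) (G * A) (G * A * Gᵀ + H * B * Hᵀ)).PosSemidef := by
  rw [← fromRows_one_mul_mul_transpose_add]
  exact (posSemidef_mul_mul_transpose hA _).add (posSemidef_mul_mul_transpose hB _)

end Gaussian

/-! ### Coordinates on the subspace -/

section BasisMatrix

variable {d k m : ℕ} {E : Submodule ℝ (EuclideanSpace ℝ (Fin d))}
  (v : OrthonormalBasis (Fin k) ℝ E) (w : OrthonormalBasis (Fin m) ℝ Eᗮ)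

lemma matrixCLM_transpose_basisMatrix (x : EuclideanSpace ℝ (Fin d)) :
    matrixCLM (basisMatrix v)ᵀ x = v.repr (E.orthogonalProjectionOnto x) := by
  ext j
  rw [v.repr_apply_apply, ← real_inner_comm,
    E.inner_orthogonalProjectionOnto_eq_of_mem_right]
  simp [basisMatrix, Matrix.mulVec, dotProduct, PiLp.inner_apply]

lemma matrixCLM_basisMatrix (c : EuclideanSpace ℝ (Fin k)) :
    matrixCLM (basisMatrix v) c = (v.repr.symm c : EuclideanSpace ℝ (Fin d)) := by
  rw [← v.sum_repr_symm c]
  ext i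
  simp [basisMatrix, Matrix.mulVec, dotProduct, mul_comm]

/-- Every vector is the sum of its projections on `E` and on `Eᗮ`. -/
lemma basisMatrix_mul_transpose_add :
    basisMatrix v * (basisMatrix v)ᵀ + basisMatrix w * (basisMatrix w)ᵀ = 1 := by
  have h (x : EuclideanSpace ℝ (Fin d)) :
      matrixCLM (basisMatrix v * (basisMatrix v)ᵀ) x +
        matrixCLM (basisMatrix w * (basisMatrix w)ᵀ) x = x := by
    simp_rw [← matrixCLM_matrixCLM, matrixCLM_transpose_basisMatrix, matrixCLM_basisMatrix]
    simp
  refine Matrix.ext_of_mulVec_single fun i => ?_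
  have := congrArg WithLp.ofLp (h (WithLp.toLp 2 (Pi.single i 1)))
  rw [Matrix.add_mulVec, Matrix.one_mulVec]
  exact this

end BasisMatrix

/-! ### Regression on the subspace -/

section Regression

variable {d k m : ℕ} {A B : Matrix (Fin d) (Fin d) ℝ} {V : Matrix (Fin d) (Fin k) ℝ}
  {W : Matrix (Fin d) (Fin m) ℝ}

/-- The matrix `B V (Vᵀ B V)⁻¹` of the linear regression of a vector with covariance `B` on its
coordinates `Vᵀ x`. -/
noncomputable def regressionMatrix (B : Matrix (Fin d) (Fin d) ℝ) (V : Matrix (Fin d) (Fin k) ℝ) :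
    Matrix (Fin d) (Fin k) ℝ :=
  B * V * (Vᵀ * B * V)⁻¹

/-- The matrix of the residual `x - B V (Vᵀ B V)⁻¹ Vᵀ x` of the regression on `Vᵀ x`. -/
noncomputable def residualMatrix (B : Matrix (Fin d) (Fin d) ℝ) (V : Matrix (Fin d) (Fin k) ℝ) :
    Matrix (Fin d) (Fin d) ℝ :=
  1 - regressionMatrix B V * Vᵀ

lemma transpose_mul_regressionMatrix (hBV : (Vᵀ * B * V).PosDef) :
    Vᵀ * regressionMatrix B V = 1 := by
  rw [regressionMatrix, ← Matrix.mul_assoc, ← Matrix.mul_assoc]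
  exact Matrix.mul_nonsing_inv _ ((Matrix.isUnit_iff_isUnit_det _).1 hBV.isUnit)

lemma transpose_mul_residualMatrix (hBV : (Vᵀ * B * V).PosDef) :
    Vᵀ * residualMatrix B V = 0 := by
  rw [residualMatrix, Matrix.mul_sub, ← Matrix.mul_assoc, transpose_mul_regressionMatrix hBV]
  simp

lemma transpose_regressionMatrix (hB : B.IsHermitian) (hBV : (Vᵀ * B * V).PosDef) :
    (regressionMatrix B V)ᵀ = (Vᵀ * B * V)⁻¹ * Vᵀ * B := by
  have h1 : Bᵀ = B := by simpa using hB.eq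
  have h2 : ((Vᵀ * B * V)⁻¹)ᵀ = (Vᵀ * B * V)⁻¹ := by simpa using hBV.inv.isHermitian.eq
  rw [regressionMatrix, Matrix.transpose_mul, Matrix.transpose_mul, h1, h2,
    ← Matrix.mul_assoc]

/-- The covariances of the regression and of its residual add up to `B`. -/
lemma regression_add_residual (hB : B.IsHermitian) (hBV : (Vᵀ * B * V).PosDef) :
    regressionMatrix B V * (Vᵀ * B * V) * (regressionMatrix B V)ᵀ +
      residualMatrix B V * B * (residualMatrix B V)ᵀ = B := by
  have hdet := (Matrix.isUnit_iff_isUnit_det _).1 hBV.isUnit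
  have hBL : B * V = regressionMatrix B V * (Vᵀ * B * V) := by
    rw [regressionMatrix, Matrix.mul_assoc _ _ (Vᵀ * B * V), Matrix.nonsing_inv_mul _ hdet,
      Matrix.mul_one]
  have hLB : Vᵀ * B = (Vᵀ * B * V) * (regressionMatrix B V)ᵀ := by
    rw [transpose_regressionMatrix hB hBV, Matrix.mul_assoc _ Vᵀ, ← Matrix.mul_assoc,
      Matrix.mul_nonsing_inv _ hdet, Matrix.one_mul]
  set L := regressionMatrix B V with hL
  have hexp : residualMatrix B V * B * (residualMatrix B V)ᵀ =
      B - L * (Vᵀ * B) - (B * V) * Lᵀ + L * (Vᵀ * B * V) * Lᵀ := by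
    rw [residualMatrix, ← hL, Matrix.transpose_sub, Matrix.transpose_mul, Matrix.transpose_one,
      Matrix.transpose_transpose]
    simp only [Matrix.sub_mul, Matrix.mul_sub, Matrix.mul_one, Matrix.one_mul, Matrix.mul_assoc]
    abel
  have h1 : L * (Vᵀ * B) = L * (Vᵀ * B * V) * Lᵀ := by rw [Matrix.mul_assoc L, ← hLB]
  have h2 : B * V * Lᵀ = L * (Vᵀ * B * V) * Lᵀ := by rw [← hBL]
  rw [hexp, h1, h2]
  abel

/-- Completeness of the two bases turns the two outer factors of the cross-covariance into `A V`
and the transposed regression matrix of `B`. -/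
lemma crossCovariance_eq (hA : A.PosSemidef) (hB : B.PosSemidef) (hAV : (Vᵀ * A * V).PosDef)
    (hBV : (Vᵀ * B * V).PosDef) (hVW : V * Vᵀ + W * Wᵀ = 1) :
    crossCovariance A B V W =
      A * (regressionMatrix B V * mongeMatrix (Vᵀ * A * V) (Vᵀ * B * V) * Vᵀ)ᵀ := by
  have hAT : Aᵀ = A := by simpa using hA.isHermitian.eq
  have hT : (mongeMatrix (Vᵀ * A * V) (Vᵀ * B * V))ᵀ = mongeMatrix (Vᵀ * A * V) (Vᵀ * B * V) := by
    simpa using (posDef_mongeMatrix hAV hBV).isHermitian.eq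
  have hdet := (Matrix.isUnit_iff_isUnit_det _).1 hBV.isUnit
  have h1 : V * (Vᵀ * A * V) + W * (Vᵀ * A * W)ᵀ = A * V := by
    calc V * (Vᵀ * A * V) + W * (Vᵀ * A * W)ᵀ = (V * Vᵀ + W * Wᵀ) * (A * V) := by
          simp only [Matrix.transpose_mul, hAT, Matrix.transpose_transpose, Matrix.add_mul,
            Matrix.mul_assoc]
      _ = A * V := by rw [hVW, Matrix.one_mul]
  have h2 : Vᵀ + (Vᵀ * B * V)⁻¹ * (Vᵀ * B * W) * Wᵀ = (Vᵀ * B * V)⁻¹ * Vᵀ * B := by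
    calc Vᵀ + (Vᵀ * B * V)⁻¹ * (Vᵀ * B * W) * Wᵀ
        = (Vᵀ * B * V)⁻¹ * (Vᵀ * B * V) * Vᵀ + (Vᵀ * B * V)⁻¹ * (Vᵀ * B * W) * Wᵀ := by
          rw [Matrix.nonsing_inv_mul _ hdet, Matrix.one_mul]
      _ = (Vᵀ * B * V)⁻¹ * Vᵀ * B * (V * Vᵀ + W * Wᵀ) := by
          simp only [Matrix.mul_add, Matrix.mul_assoc]
      _ = (Vᵀ * B * V)⁻¹ * Vᵀ * B := by rw [hVW, Matrix.mul_one]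
  rw [crossCovariance, h1, h2, ← transpose_regressionMatrix hB.isHermitian hBV,
    Matrix.transpose_mul, Matrix.transpose_mul, hT, Matrix.transpose_transpose]
  simp only [Matrix.mul_assoc]

end Regression

/-! ### The disintegration of a Gaussian measure -/

section FiberKernel

variable {d k : ℕ} {E : Submodule ℝ (EuclideanSpace ℝ (Fin d))}
  (v : OrthonormalBasis (Fin k) ℝ E) {A B : Matrix (Fin d) (Fin d) ℝ}

lemma marginal_multivariateGaussian (hB : B.PosSemidef) :
    marginal E (multivariateGaussian 0 B) =
      (multivariateGaussian 0 ((basisMatrix v)ᵀ * B * basisMatrix v)).map v.repr.symm := by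
  have h := map_matrixCLM_multivariateGaussian hB (basisMatrix v)ᵀ
  rw [Matrix.transpose_transpose] at h
  rw [← h, Measure.map_map (by fun_prop) (by fun_prop), marginal]
  congr 1
  funext x
  simp [matrixCLM_transpose_basisMatrix]

/-- The conditional law of `z ~ N(0, B)` given `P_E z = y`: the regression on `E` evaluated at `y`
plus the residual of `z`. -/
noncomputable def fiberKernel (B : Matrix (Fin d) (Fin d) ℝ) :
    Kernel E (EuclideanSpace ℝ (Fin d)) :=
  (Kernel.id ×ₖ Kernel.const E (multivariateGaussian 0 B)).map fun p =>
    matrixCLM (regressionMatrix B (basisMatrix v)) (v.repr p.1) +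
      matrixCLM (residualMatrix B (basisMatrix v)) p.2

instance : IsMarkovKernel (fiberKernel v B) :=
  Kernel.IsMarkovKernel.map _ (by fun_prop)

lemma fiberKernel_apply (y : E) :
    fiberKernel v B y = (multivariateGaussian 0 B).map fun z =>
      matrixCLM (regressionMatrix B (basisMatrix v)) (v.repr y) +
        matrixCLM (residualMatrix B (basisMatrix v)) z := by
  rw [fiberKernel, Kernel.map_apply _ (by fun_prop), Kernel.prod_apply, Kernel.id_apply,
    Kernel.const_apply, Measure.dirac_prod, Measure.map_map (by fun_prop) (by fun_prop)]
  rfl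

/-- Sampling from the fibre kernel amounts to adding an independent Gaussian residual. -/
lemma compProd_comap_fiberKernel {α : Type*} [MeasurableSpace α] (ρ : Measure α) [SFinite ρ]
    {f : α → E} (hf : Measurable f) :
    ρ ⊗ₘ ((fiberKernel v B).comap f hf) = (ρ.prod (multivariateGaussian 0 B)).map fun p =>
      (p.1, matrixCLM (regressionMatrix B (basisMatrix v)) (v.repr (f p.1)) +
        matrixCLM (residualMatrix B (basisMatrix v)) p.2) := by
  have hm : Measurable fun p : α × EuclideanSpace ℝ (Fin d) =>
      (p.1, matrixCLM (regressionMatrix B (basisMatrix v)) (v.repr (f p.1)) +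
        matrixCLM (residualMatrix B (basisMatrix v)) p.2) := by fun_prop
  ext s hs
  rw [Measure.compProd_apply hs, Measure.map_apply hm hs, Measure.prod_apply (hm hs)]
  refine lintegral_congr fun x => ?_
  rw [Kernel.comap_apply, fiberKernel_apply,
    Measure.map_apply (by fun_prop) (measurable_prodMk_left hs)]
  rfl

lemma isDisintegration_fiberKernel (hB : B.PosSemidef)
    (hBE : ((basisMatrix v)ᵀ * B * basisMatrix v).PosDef) :
    IsDisintegration E (multivariateGaussian 0 B) (fiberKernel v B) where
  isMarkovKernel := inferInstance
  fiber := by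
    refine ae_of_all _ fun y => ?_
    rw [fiberKernel_apply, ae_map_iff (by fun_prop)
      (measurableSet_eq_fun (by fun_prop) (by fun_prop))]
    refine ae_of_all _ fun z => v.repr.injective ?_
    rw [← matrixCLM_transpose_basisMatrix, map_add, matrixCLM_matrixCLM, matrixCLM_matrixCLM,
      transpose_mul_regressionMatrix hBE, transpose_mul_residualMatrix hBE]
    simp
  mixture := by
    rw [← Measure.snd_compProd, ← Kernel.comap_id (fiberKernel v B),
      compProd_comap_fiberKernel, Measure.snd, Measure.map_map (by fun_prop) (by fun_prop),
      marginal_multivariateGaussian v hB]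
    have hp : ((multivariateGaussian 0 ((basisMatrix v)ᵀ * B * basisMatrix v)).map
          v.repr.symm).prod (multivariateGaussian 0 B) =
        ((multivariateGaussian 0 ((basisMatrix v)ᵀ * B * basisMatrix v)).prod
          (multivariateGaussian 0 B)).map (Prod.map v.repr.symm id) := by
      rw [← Measure.map_prod_map _ _ (by fun_prop) (by fun_prop), Measure.map_id]
    rw [hp, Measure.map_map (by fun_prop) (by fun_prop)]
    refine Eq.trans ?_ ((map_add_matrixCLM_prod_multivariateGaussian hBE.posSemidef hB _ _).trans
      (congrArg _ (regression_add_residual hB.isHermitian hBE)))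
    congr 1
    funext z
    simp

end FiberKernel

/-! ### The Monge map between the marginals -/

section GaussianMongeMap

variable {d k : ℕ} {E : Submodule ℝ (EuclideanSpace ℝ (Fin d))}
  (v : OrthonormalBasis (Fin k) ℝ E) {A B : Matrix (Fin d) (Fin d) ℝ}

/-- The endomorphism of `E` with matrix `M` in the orthonormal basis `v`. -/
noncomputable def basisCLM (M : Matrix (Fin k) (Fin k) ℝ) : E →L[ℝ] E :=
  (v.repr.symm.toContinuousLinearEquiv : EuclideanSpace ℝ (Fin k) →L[ℝ] E) ∘L matrixCLM M ∘L
    (v.repr.toContinuousLinearEquiv : E →L[ℝ] EuclideanSpace ℝ (Fin k))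

lemma basisCLM_apply (M : Matrix (Fin k) (Fin k) ℝ) (x : E) :
    basisCLM v M x = v.repr.symm (matrixCLM M (v.repr x)) := rfl

lemma inner_basisCLM_left (M : Matrix (Fin k) (Fin k) ℝ) (x y : E) :
    inner ℝ (basisCLM v M x) y = inner ℝ x (basisCLM v Mᵀ y) := by
  rw [basisCLM_apply, basisCLM_apply, ← v.repr.inner_map_map, ← v.repr.inner_map_map x]
  simp [inner_matrixCLM_left]

lemma inner_basisCLM_self_pos {M : Matrix (Fin k) (Fin k) ℝ} (hM : M.PosDef) {x : E}
    (hx : x ≠ 0) : 0 < inner ℝ (basisCLM v M x) x := by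
  rw [basisCLM_apply, ← v.repr.inner_map_map]
  have h : (v.repr x).ofLp ≠ 0 := by simpa using hx
  simpa [EuclideanSpace.inner_eq_star_dotProduct] using hM.dotProduct_mulVec_pos h

lemma map_basisCLM_marginal (hA : A.PosSemidef) (hB : B.PosSemidef)
    {M : Matrix (Fin k) (Fin k) ℝ} (hM : M * ((basisMatrix v)ᵀ * A * basisMatrix v) * Mᵀ =
      (basisMatrix v)ᵀ * B * basisMatrix v) :
    (marginal E (multivariateGaussian 0 A)).map (basisCLM v M) =
      marginal E (multivariateGaussian 0 B) := by
  have hAE := posSemidef_mul_mul_transpose hA (basisMatrix v)ᵀ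
  rw [Matrix.transpose_transpose] at hAE
  rw [marginal_multivariateGaussian v hA, marginal_multivariateGaussian v hB, ← hM,
    ← map_matrixCLM_multivariateGaussian hAE, Measure.map_map (by fun_prop) (by fun_prop),
    Measure.map_map (by fun_prop) (by fun_prop)]
  congr 1
  funext x
  simp [basisCLM_apply]

lemma memLp_two_id_marginal : MemLp id 2 (marginal E (multivariateGaussian 0 A)) := by
  unfold marginal
  exact IsGaussian.memLp_two_id

/-- The linear map with matrix `T^{A_E B_E}` is, up to almost everywhere equality, the only Monge
map between the Gaussian marginals. -/
lemma isMongeMap_basisCLM (hA : A.PosSemidef) (hB : B.PosSemidef)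
    (hAE : ((basisMatrix v)ᵀ * A * basisMatrix v).PosDef)
    (hBE : ((basisMatrix v)ᵀ * B * basisMatrix v).PosDef) :
    IsMongeMap (marginal E (multivariateGaussian 0 A)) (marginal E (multivariateGaussian 0 B))
        (basisCLM v (mongeMatrix ((basisMatrix v)ᵀ * A * basisMatrix v)
          ((basisMatrix v)ᵀ * B * basisMatrix v))) ∧
      ∀ S, IsMongeMap (marginal E (multivariateGaussian 0 A))
          (marginal E (multivariateGaussian 0 B)) S →
        S =ᵐ[marginal E (multivariateGaussian 0 A)]
          basisCLM v (mongeMatrix ((basisMatrix v)ᵀ * A * basisMatrix v)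
            ((basisMatrix v)ᵀ * B * basisMatrix v)) := by
  have hT := posDef_mongeMatrix hAE hBE
  have hTBT := mongeMatrix_mul_mul_mongeMatrix hAE hBE.posSemidef
  set T := mongeMatrix ((basisMatrix v)ᵀ * A * basisMatrix v)
    ((basisMatrix v)ᵀ * B * basisMatrix v)
  have hTT : Tᵀ = T := by simpa using hT.isHermitian.eq
  have hTi : (T⁻¹)ᵀ = T⁻¹ := by simpa using hT.inv.isHermitian.eq
  have hmap := map_basisCLM_marginal v (M := T) hA hB (by rw [hTT, hTBT])
  have hsymm (x y : E) : inner ℝ (basisCLM v T⁻¹ x) y = inner ℝ x (basisCLM v T⁻¹ y) := by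
    rw [inner_basisCLM_left, hTi]
  have hinv (x : E) : basisCLM v T⁻¹ (basisCLM v T x) = x := by
    simp [basisCLM_apply, matrixCLM_matrixCLM,
      Matrix.nonsing_inv_mul _ ((Matrix.isUnit_iff_isUnit_det _).1 hT.isUnit)]
  have hpos (x : E) (hx : x ≠ 0) : 0 < inner ℝ (basisCLM v T⁻¹ x) x :=
    inner_basisCLM_self_pos v hT.inv hx
  rw [← hmap]
  refine ⟨isMongeMap_of_leftInverse hsymm hinv (fun x => ?_) memLp_two_id_marginal,
    fun S hS => hS.ae_eq_of_leftInverse hsymm hinv hpos memLp_two_id_marginal⟩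
  rcases eq_or_ne x 0 with rfl | hx
  · simp
  · exact (hpos x hx).le

end GaussianMongeMap

end SubspaceDetours

/-! ### The Monge-Independent plan -/

open SubspaceDetours in
theorem mainTheorem3 (d k m : ℕ) (E : Submodule ℝ (EuclideanSpace ℝ (Fin d)))
    (v : OrthonormalBasis (Fin k) ℝ E) (w : OrthonormalBasis (Fin m) ℝ Eᗮ)
    (A B : Matrix (Fin d) (Fin d) ℝ) (hA : A.PosSemidef) (hB : B.PosSemidef)
    (hAE : ((SubspaceDetours.basisMatrix v)ᵀ * A * SubspaceDetours.basisMatrix v).PosDef)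
    (hBE : ((SubspaceDetours.basisMatrix v)ᵀ * B * SubspaceDetours.basisMatrix v).PosDef)
    (C : Matrix (Fin d) (Fin d) ℝ)
    (hC : C = SubspaceDetours.crossCovariance A B
      (SubspaceDetours.basisMatrix v) (SubspaceDetours.basisMatrix w)) :
    (Matrix.fromBlocks A C Cᵀ B).PosSemidef ∧
    ∀ π : Measure (EuclideanSpace ℝ (Fin d) × EuclideanSpace ℝ (Fin d)),
      SubspaceDetours.IsMongeIndependentPlan E
          (multivariateGaussian 0 A) (multivariateGaussian 0 B) π ↔
        π = SubspaceDetours.gaussianProd (Matrix.fromBlocks A C Cᵀ B) := by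
  obtain ⟨hmonge, huniq⟩ := isMongeMap_basisCLM v hA hB hAE hBE
  have hAT : Aᵀ = A := by simpa using hA.isHermitian.eq
  have hTT : (mongeMatrix ((basisMatrix v)ᵀ * A * basisMatrix v)
      ((basisMatrix v)ᵀ * B * basisMatrix v))ᵀ = mongeMatrix ((basisMatrix v)ᵀ * A * basisMatrix v)
      ((basisMatrix v)ᵀ * B * basisMatrix v) := by
    simpa using (posDef_mongeMatrix hAE hBE).isHermitian.eq
  have hTBT := mongeMatrix_mul_mul_mongeMatrix hAE hBE.posSemidef
  rw [crossCovariance_eq hA hB hAE hBE (basisMatrix_mul_transpose_add v w)] at hC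
  set V := basisMatrix v
  set T := mongeMatrix (Vᵀ * A * V) (Vᵀ * B * V)
  set L := regressionMatrix B V
  have hCT : Cᵀ = L * T * Vᵀ * A := by
    rw [hC, Matrix.transpose_mul, Matrix.transpose_transpose, hAT]
  -- `Σ` is the covariance of `(x, L T Vᵀ x + R z)`, where `R` is the residual matrix of `B`.
  have hblocks : fromBlocks A C Cᵀ B = fromBlocks A (A * (L * T * Vᵀ)ᵀ) (L * T * Vᵀ * A)
      (L * T * Vᵀ * A * (L * T * Vᵀ)ᵀ + residualMatrix B V * B * (residualMatrix B V)ᵀ) := by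
    have h : L * T * Vᵀ * A * (L * T * Vᵀ)ᵀ = L * (Vᵀ * B * V) * Lᵀ := by
      rw [← hTBT]
      simp only [Matrix.transpose_mul, Matrix.transpose_transpose, hTT, Matrix.mul_assoc]
    rw [h, regression_add_residual hB.isHermitian hBE, ← hC, ← hCT]
  have hplan {S : E → E} {κ η : Kernel E (EuclideanSpace ℝ (Fin d))}
      (hS : IsMongeMap (marginal E (multivariateGaussian 0 A))
        (marginal E (multivariateGaussian 0 B)) S)
      (hκ : IsDisintegration E (multivariateGaussian 0 A) κ)
      (hη : IsDisintegration E (multivariateGaussian 0 B) η) :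
      (((marginal E (multivariateGaussian 0 A)).map fun x => (x, S x)).bind
        fun p => (κ p.1).prod (η p.2)) = gaussianProd (fromBlocks A C Cᵀ B) := by
    have := hη.isMarkovKernel
    rw [bind_prod_eq_compProd hS.measurable (basisCLM v T).measurable hS.map_eq (huniq S hS) hκ
        (hη.ae_eq (isDisintegration_fiberKernel v hB hBE)),
      compProd_comap_fiberKernel, hblocks, ← map_prod_multivariateGaussian_eq_gaussianProd hA hB]
    congr 1
    funext p
    rw [basisCLM_apply, LinearIsometryEquiv.apply_symm_apply, ← matrixCLM_transpose_basisMatrix,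
      matrixCLM_matrixCLM, matrixCLM_matrixCLM]
  refine ⟨hblocks ▸ posSemidef_fromBlocks_mul hA hB _ _, fun π => ⟨?_, ?_⟩⟩
  · rintro ⟨S, κ, η, hS, hκ, hη, rfl⟩
    exact hplan hS hκ hη
  · rintro rfl
    exact ⟨_, _, _, hmonge, isDisintegration_fiberKernel v hA hAE,
      isDisintegration_fiberKernel v hB hBE,
      (hplan hmonge (isDisintegration_fiberKernel v hA hAE)
        (isDisintegration_fiberKernel v hB hBE)).symm⟩
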